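/- Let $f_1,f_2,g_1,g_2:\mathbb{R}\to\mathbb{R}$ be locally Lipschitz, let $h_1,h_2:\mathbb{R}\to\mathbb{R}$ be strictly increasing and locally Lipschitz, and let $c:\mathbb{R}^3\to\mathbb{R}$ be locally Lipschitz, such that - $f_1(0)=f_2(0)=g_1(0)=g_2(0)=h_1(0)=h_2(0)=0$; - $f_1(z)>0$ and $f_2(z)<0$ for all $z<0$; $f_1(z)<0$ and $f_2(z)>0$ for all $z>0$; - $g_1(v)>0$ and $g_2(v)=0$ for all $v>0$; $g_1(v)=0$ and $g_2(v)<0$ for all $v<0$; - $c(x,z,0)=0$ and $v\,c(x,z,v)\ge 0$ for all $x,z,v\in\mathbb{R}$. Consider the autonomous system on $\mathbb{R}^3$ $$\dot x=v,\qquad \dot z=v+f_1(z)g_1(v)+f_2(z)g_2(v),\qquad \dot v=-h_1(x)-h_2(z)-c(x,z,v).\tag{1}$$ Put $$\mathcal V(x,z,v)=\int_0^x h_1(s)\,ds+\int_0^z h_2(s)\,ds+\tfrac12 v^2,\qquad \mathcal S_{X}=\{Y\in\mathbb{R}^3:\mathcal V(Y)\le\mathcal V(X)\},$$ $$\mathcal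 E=\{(x,z,v)\in\mathbb{R}^3: h_1(x)=-h_2(z),\ v=0\}.$$ Let $X:[0,\infty)\to\mathbb{R}^3$ be a solution of (1), and let $X_0=X(0)$. Let $\mathcal O_{X_0}^{+\infty}$ be the positive limit set of $X_0$, that is, the set of all $p\in\mathbb{R}^3$ such that, for some solution $Y:[0,\infty)\to\mathbb{R}^3$ of (1) with $Y(0)=X_0$ and some nondecreasing sequence of positive reals $t_n\to+\infty$, $Y(t_n)\to p$. (Since (1) has locally Lipschitz right-hand side, necessarily $Y=X$.) Then 1. $\mathcal O_{X_0}^{+\infty}$ is nonempty, compact and connected; 2. $\mathcal O_{X_0}^{+\infty}$ is invariant: every solution of (1) on $[0,\infty)$ that starts in $\mathcal O_{X_0}^{+\infty}$ remains in it, and for every $p\in\mathcal O_{X_0}^{+\infty}$ and $T\ge 0$ there is a solution $Y:[0,T]\to\mathcal O_{X_0}^{+\infty}$ of (1) with $Y(T)=p$; 3. $X(t)$ converges to $\mathcal O_{X_0}^{+\infty}$ as $t\to+\infty$: for every $\varepsilon>0$ there is $T>0$ such that $\inf_{p\in\mathcal O_{X_0}^{+\infty}} d(X(t),p)<\varepsilon$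 for all $t>T$; 4. $\mathcal O_{X_0}^{+\infty}\subseteq\mathcal S_{X_0}\cap\mathcal E$. -/

import Mathlib

open Set Filter Topology

/-! ### Autonomous systems `ẋ = f(x)`

A solution of `ẋ = f(x)` on an interval `I` is a function `x` with
`IsIntegralCurveOn x (fun _ => f) I`: for every `t ∈ I`, `x` has derivative `f (x t)` at `t` within
`I`. Only the values of `x` on `I` matter. -/

namespace AutonomousODE

variable {E : Type*} [NormedAddCommGroup E] [NormedSpace ℝ E]

/-- The positive limit set of the point `z`: the points `p` for which there are a solution `x` on
`[0, ∞)` with `x 0 = z` and a nondecreasing sequence of positive times `t n → ∞` with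
`x (t n) → p`. -/
def positiveLimitSet (f : E → E) (z : E) : Set E :=
  {p | ∃ x : ℝ → E, IsIntegralCurveOn x (fun _ => f) (Ici 0) ∧ x 0 = z ∧
    ∃ t : ℕ → ℝ, Monotone t ∧ (∀ n, 0 < t n) ∧ Tendsto t atTop atTop ∧
      Tendsto (fun n => x (t n)) atTop (𝓝 p)}

/-- Every solution on `[0, ∞)` that starts in `U` stays in `U`. -/
def PositivelyInvariant (f : E → E) (U : Set E) : Prop :=
  ∀ x : ℝ → E, IsIntegralCurveOn x (fun _ => f) (Ici 0) → x 0 ∈ U → ∀ t, 0 ≤ t → x t ∈ U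

/-- Every point of `U` is reached, after any prescribed time `T ≥ 0`, by a solution on `[0, T]`
with values in `U`. -/
def NegativelyInvariant (f : E → E) (U : Set E) : Prop :=
  ∀ z ∈ U, ∀ T : ℝ, 0 ≤ T →
    ∃ x : ℝ → E, IsIntegralCurveOn x (fun _ => f) (Icc 0 T) ∧ (∀ t ∈ Icc 0 T, x t ∈ U) ∧ x T = z

/-- A set is invariant if it is both positively and negatively invariant. -/
def Invariant (f : E → E) (U : Set E) : Prop :=
  PositivelyInvariant f U ∧ NegativelyInvariant f U

/-- Convergence of a trajectory to a set `A` as `t → +∞`. The extended distance is used so that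
the infimum over the empty set is `+∞`. -/
def ConvergesToSet (x : ℝ → E) (A : Set E) : Prop :=
  ∀ ε : ℝ, 0 < ε → ∃ T : ℝ, 0 < T ∧ ∀ t, T < t → Metric.infEDist (x t) A < ENNReal.ofReal ε

end AutonomousODE

/-! ### The mechanical oscillator with a Duhem-type element

A state is `X = (x, z, v)`, that is, `X 0 = x`, `X 1 = z`, `X 2 = v`. -/

namespace DuhemOscillator

/-- The right-hand side of `ẋ = v`, `ż = v + f₁(z) g₁(v) + f₂(z) g₂(v)`,
`v̇ = -h₁(x) - h₂(z) - c(x, z, v)`. -/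
noncomputable def field (f₁ f₂ g₁ g₂ h₁ h₂ : ℝ → ℝ) (c : EuclideanSpace ℝ (Fin 3) → ℝ)
    (X : EuclideanSpace ℝ (Fin 3)) : EuclideanSpace ℝ (Fin 3) :=
  !₂[X 2, X 2 + f₁ (X 1) * g₁ (X 2) + f₂ (X 1) * g₂ (X 2), -h₁ (X 0) - h₂ (X 1) - c X]

/-- The set `E = {(x, z, v) : h₁(x) = -h₂(z), v = 0}`. -/
def equilibriumSet (h₁ h₂ : ℝ → ℝ) : Set (EuclideanSpace ℝ (Fin 3)) :=
  {X | h₁ (X 0) = -h₂ (X 1) ∧ X 2 = 0}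

/-- The function `V(x, z, v) = ∫₀ˣ h₁ + ∫₀ᶻ h₂ + v² / 2`. -/
noncomputable def energy (h₁ h₂ : ℝ → ℝ) (X : EuclideanSpace ℝ (Fin 3)) : ℝ :=
  (∫ s in (0 : ℝ)..(X 0), h₁ s) + (∫ s in (0 : ℝ)..(X 1), h₂ s) + 1 / 2 * X 2 ^ 2

/-- The sublevel set `S_X = {Y : V(Y) ≤ V(X)}`. -/
def sublevelSet (h₁ h₂ : ℝ → ℝ) (X : EuclideanSpace ℝ (Fin 3)) :
    Set (EuclideanSpace ℝ (Fin 3)) :=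
  {Y | energy h₁ h₂ Y ≤ energy h₁ h₂ X}

end DuhemOscillator

/-!
The proof follows LaSalle's invariance principle. Along the solutions the energy
`V = ∫₀ˣ h₁ + ∫₀ᶻ h₂ + v² / 2` has derivative `h₂(z) (f₁(z) g₁(v) + f₂(z) g₂(v)) - v c`, which is
nonpositive, and negative as soon as `z` and `v` are both nonzero (`hasDerivWithinAt_energy`,
`power_nonpos`, `power_neg`). The primitives of `h₁` and `h₂` grow at least linearly at `±∞`, so
the sublevel sets of `V` are compact (`isCompact_sublevelSet`) and `X` stays in one of them. By
uniqueness of solutions the positive limit set is the set of cluster points of `X`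
(`positiveLimitSet_eq_clusterSet`), and for a continuous curve in a compact set this set is
nonempty, compact, connected and attracts the curve.

If `p` is in the limit set, the local solution `Y` issued from `p` is a limit of time translates of
`X`, by Grönwall's inequality (`tendsto_shift_of_tendsto`). As `V` converges along `X`, it is
constant along `Y` (`eq_of_mapClusterPt_of_antitone`). Zero dissipation forces `z = 0` or `v = 0`
along `Y`. A nonzero velocity at some time would give `z = 0` around that time, whereas then
`ż = v ≠ 0`; hence `v` vanishes along `Y`, and so does `v̇ = -h₁(x) - h₂(z)`: the point `p` is in `E`
(`mem_equilibriumSet_of_energy_constant`).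

Positive invariance of the limit set is again continuous dependence on the initial state. Negative
invariance needs no backward solution: the limit set consists of equilibria, whose constant
solutions remain in it.
-/

/-! ### Cluster points of a precompact trajectory -/

namespace AutonomousODE

section ClusterSet

variable {M : Type*} [MetricSpace M] {K : Set M} {X : ℝ → M}

theorem isClosed_clusterSet (X : ℝ → M) : IsClosed {p | MapClusterPt p atTop X} :=
  isClosed_setOfPred_clusterPt

/-- A trajectory in a compact set eventually enters every open set that contains its cluster
points: otherwise it would have a cluster point in the complement. -/
theorem eventually_mem_of_clusterSet_subset (hK : IsCompact K) (hX : ∀ t, 0 ≤ t → X t ∈ K)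
    {U : Set M} (hU : IsOpen U) (hLU : {p | MapClusterPt p atTop X} ⊆ U) :
    ∀ᶠ t in atTop, X t ∈ U := by
  by_contra hcon
  have hfreq : ∃ᶠ t in atTop, X t ∈ K \ U :=
    ((not_eventually.1 hcon).and_eventually (eventually_ge_atTop 0)).mono
      fun t ht => ⟨hX t ht.2, ht.1⟩
  obtain ⟨p, hp, hpX⟩ := (hK.diff hU).exists_mapClusterPt_of_frequently hfreq
  exact hp.2 (hLU hpX)

theorem clusterSet_nonempty (hK : IsCompact K) (hX : ∀ t, 0 ≤ t → X t ∈ K) :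
    {p | MapClusterPt p atTop X}.Nonempty := by
  obtain ⟨p, -, hp⟩ := hK.exists_mapClusterPt_of_frequently
    ((eventually_ge_atTop (0 : ℝ)).mono hX).frequently
  exact ⟨p, hp⟩

theorem clusterSet_subset (hK : IsCompact K) (hX : ∀ t, 0 ≤ t → X t ∈ K) :
    {p | MapClusterPt p atTop X} ⊆ K := fun p hp => by
  rw [← hK.isClosed.closure_eq]
  exact mem_closure_iff_frequently.2
    (ClusterPt.frequently' hp ((eventually_ge_atTop (0 : ℝ)).mono hX))

theorem isCompact_clusterSet (hK : IsCompact K) (hX : ∀ t, 0 ≤ t → X t ∈ K) :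
    IsCompact {p | MapClusterPt p atTop X} :=
  hK.of_isClosed_subset (isClosed_clusterSet X) (clusterSet_subset hK hX)

/-- If the cluster set split into two disjoint closed pieces, the tail of the trajectory, which is
connected, would lie in the union of two disjoint neighbourhoods and visit both. -/
theorem isConnected_clusterSet (hK : IsCompact K) (hX : ∀ t, 0 ≤ t → X t ∈ K)
    (hc : ContinuousOn X (Ici 0)) : IsConnected {p | MapClusterPt p atTop X} := by
  refine ⟨clusterSet_nonempty hK hX, isPreconnected_closed_iff.2 ?_⟩
  rintro t t' ht ht' hsub ⟨a, haL, hat⟩ ⟨b, hbL, hbt'⟩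
  by_contra hemp
  have hL := isCompact_clusterSet hK hX
  have hdisj : Disjoint ({p | MapClusterPt p atTop X} ∩ t) ({p | MapClusterPt p atTop X} ∩ t') :=
    Set.disjoint_left.2 fun p hp hp' => hemp ⟨p, hp.1, hp.2, hp'.2⟩
  obtain ⟨U, V, hU, hV, hAU, hBV, hUV⟩ :=
    SeparatedNhds.of_isCompact_isCompact (hL.inter_right ht) (hL.inter_right ht') hdisj
  have hev : ∀ᶠ s in atTop, X s ∈ U ∪ V :=
    eventually_mem_of_clusterSet_subset hK hX (hU.union hV) fun p hp =>
      (hsub hp).imp (fun h => hAU ⟨hp, h⟩) (fun h => hBV ⟨hp, h⟩)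
  obtain ⟨T, hT⟩ := eventually_atTop.1 (hev.and (eventually_ge_atTop 0))
  have hpre : IsPreconnected (X '' Ici T) :=
    isPreconnected_Ici.image X (hc.mono fun s hs => (hT s hs).2)
  have hvisit : ∀ {W : Set M} {p : M}, IsOpen W → p ∈ W → MapClusterPt p atTop X →
      (X '' Ici T ∩ W).Nonempty := by
    intro W p hW hpW hp
    obtain ⟨s, hs, hsT⟩ := ((mapClusterPt_iff_frequently.1 hp W (hW.mem_nhds hpW)).and_eventually
      (eventually_ge_atTop T)).exists
    exact ⟨X s, mem_image_of_mem X hsT, hs⟩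
  obtain ⟨q, -, hqU, hqV⟩ := hpre U V hU hV (by rintro _ ⟨s, hs, rfl⟩; exact (hT s hs).1)
    (hvisit hU (hAU ⟨haL, hat⟩) haL) (hvisit hV (hBV ⟨hbL, hbt'⟩) hbL)
  exact Set.disjoint_left.1 hUV hqU hqV

theorem convergesToSet_clusterSet {E : Type*} [NormedAddCommGroup E] {K : Set E} {X : ℝ → E}
    (hK : IsCompact K) (hX : ∀ t, 0 ≤ t → X t ∈ K) :
    ConvergesToSet X {p | MapClusterPt p atTop X} := by
  intro ε hε
  have hopen : IsOpen {y : E | Metric.infEDist y {p | MapClusterPt p atTop X} < ENNReal.ofReal ε} :=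
    isOpen_lt Metric.continuous_infEDist continuous_const
  have hev := eventually_mem_of_clusterSet_subset hK hX hopen fun p hp => by
    simpa [Metric.infEDist_zero_of_mem hp] using hε
  obtain ⟨T, hT⟩ := eventually_atTop.1 hev
  exact ⟨max T 1, by positivity, fun t ht => hT t ((le_max_left _ _).trans ht.le)⟩

end ClusterSet

/-! ### Solutions of a locally Lipschitz autonomous equation -/

section Flow

variable {E : Type*} [NormedAddCommGroup E] [NormedSpace ℝ E] {F : E → E}

theorem dist_le_of_isIntegralCurveOn {K : Set E} {C : NNReal} (hF : LipschitzOnWith C F K)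
    {T : ℝ} {X Y : ℝ → E} (hX : IsIntegralCurveOn X (fun _ => F) (Icc 0 T))
    (hY : IsIntegralCurveOn Y (fun _ => F) (Icc 0 T)) (hXK : ∀ t ∈ Icc 0 T, X t ∈ K)
    (hYK : ∀ t ∈ Icc 0 T, Y t ∈ K) {t : ℝ} (ht : t ∈ Icc 0 T) :
    dist (X t) (Y t) ≤ dist (X 0) (Y 0) * Real.exp (C * t) := by
  have hright : ∀ {Z : ℝ → E}, IsIntegralCurveOn Z (fun _ => F) (Icc 0 T) →
      ∀ s ∈ Ico 0 T, HasDerivWithinAt Z (F (Z s)) (Ici s) s := fun hZ s hs =>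
    (hZ s (Ico_subset_Icc_self hs)).mono_of_mem_nhdsWithin
      (mem_of_superset (Icc_mem_nhdsGE hs.2) (Icc_subset_Icc_left hs.1))
  simpa using dist_le_of_trajectories_ODE_of_mem (v := fun _ => F) (s := fun _ => K) (K := C)
    (fun _ _ => hF) hX.continuousOn (hright hX) (fun s hs => hXK s (Ico_subset_Icc_self hs))
    hY.continuousOn (hright hY) (fun s hs => hYK s (Ico_subset_Icc_self hs)) le_rfl t ht

theorem isIntegralCurveOn_shift {X : ℝ → E} (hX : IsIntegralCurveOn X (fun _ => F) (Ici 0))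
    {a : ℝ} (ha : 0 ≤ a) : IsIntegralCurveOn (fun s => X (s + a)) (fun _ => F) (Ici 0) :=
  (hX.comp_add a).mono fun s hs => by
    rw [mem_vadd_set_iff_neg_vadd_mem]
    simpa using add_nonneg ha hs

theorem eqOn_of_isIntegralCurveOn (hF : LocallyLipschitz F) {X Y : ℝ → E}
    (hX : IsIntegralCurveOn X (fun _ => F) (Ici 0))
    (hY : IsIntegralCurveOn Y (fun _ => F) (Ici 0)) (h0 : X 0 = Y 0) : EqOn X Y (Ici 0) := by
  intro t ht
  have hX' := hX.mono (Icc_subset_Ici_self : Icc 0 t ⊆ Ici 0)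
  have hY' := hY.mono (Icc_subset_Ici_self : Icc 0 t ⊆ Ici 0)
  obtain ⟨C, hC⟩ := (hF.locallyLipschitzOn (s := X '' Icc 0 t ∪ Y '' Icc 0 t))
    |>.exists_lipschitzOnWith_of_compact
    ((isCompact_Icc.image_of_continuousOn hX'.continuousOn).union
      (isCompact_Icc.image_of_continuousOn hY'.continuousOn))
  have := dist_le_of_isIntegralCurveOn hC hX' hY' (fun s hs => Or.inl (mem_image_of_mem X hs))
    (fun s hs => Or.inr (mem_image_of_mem Y hs)) ⟨ht, le_rfl⟩
  rw [h0, dist_self, zero_mul] at this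
  exact dist_le_zero.1 this

/-- Continuous dependence on the initial state: a solution issued from a limit of states `X (τ n)`
is the pointwise limit of the solution `X` translated by the times `τ n`. -/
theorem tendsto_shift_of_tendsto (hF : LocallyLipschitz F) {K : Set E} (hK : IsCompact K)
    {X : ℝ → E} (hX : IsIntegralCurveOn X (fun _ => F) (Ici 0)) (hXK : ∀ t, 0 ≤ t → X t ∈ K)
    {T : ℝ} {Y : ℝ → E} (hY : IsIntegralCurveOn Y (fun _ => F) (Icc 0 T)) {τ : ℕ → ℝ}
    (hτ : Tendsto τ atTop atTop) (hlim : Tendsto (fun n => X (τ n)) atTop (𝓝 (Y 0)))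
    {s : ℝ} (hs : s ∈ Icc 0 T) : Tendsto (fun n => X (s + τ n)) atTop (𝓝 (Y s)) := by
  obtain ⟨C, hC⟩ := (hF.locallyLipschitzOn (s := K ∪ Y '' Icc 0 T))
    |>.exists_lipschitzOnWith_of_compact
    (hK.union (isCompact_Icc.image_of_continuousOn hY.continuousOn))
  have hbound : Tendsto (fun n => dist (X (τ n)) (Y 0) * Real.exp (C * s)) atTop (𝓝 0) := by
    simpa using (tendsto_iff_dist_tendsto_zero.1 hlim).mul_const (Real.exp (C * s))
  refine tendsto_iff_dist_tendsto_zero.2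
    (squeeze_zero' (.of_forall fun _ => dist_nonneg) ?_ hbound)
  filter_upwards [hτ.eventually_ge_atTop 0] with n hn
  have := dist_le_of_isIntegralCurveOn hC
    ((isIntegralCurveOn_shift hX hn).mono (Icc_subset_Ici_self : Icc 0 T ⊆ Ici 0)) hY
    (fun r hr => Or.inl (hXK _ (add_nonneg hr.1 hn))) (fun r hr => Or.inr (mem_image_of_mem Y hr))
    hs
  simpa using this

theorem exists_isIntegralCurveOn_Icc [CompleteSpace E] (hF : LocallyLipschitz F) (p : E) :
    ∃ T > 0, ∃ Y : ℝ → E, IsIntegralCurveOn Y (fun _ => F) (Icc 0 T) ∧ Y 0 = p := by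
  obtain ⟨C, s, hs, hC⟩ := hF p
  obtain ⟨a, ha, has⟩ := Metric.nhds_basis_closedBall.mem_iff.1 hs
  lift a to NNReal using ha.le
  have ha' : (0 : ℝ) < a := ha
  set B : NNReal := ‖F p‖₊ + C * a with hB
  have hbound : ∀ x ∈ Metric.closedBall p a, ‖F x‖ ≤ B := by
    intro x hx
    have h1 : ‖F x - F p‖ ≤ C * a := by
      rw [← dist_eq_norm]
      exact (hC.dist_le_mul x (has hx) p (mem_of_mem_nhds hs)).trans
        (mul_le_mul_of_nonneg_left (Metric.mem_closedBall.1 hx) C.coe_nonneg)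
    calc ‖F x‖ ≤ ‖F p‖ + ‖F x - F p‖ := norm_le_norm_add_norm_sub' _ _
      _ ≤ B := by simpa [hB] using h1
  -- The time of existence keeps a curve of speed at most `B` inside the ball of radius `a`.
  have hT : (0 : ℝ) < a / (B + 1) := by positivity
  have hPL : IsPicardLindelof (fun _ => F) (tmin := 0) (tmax := a / (B + 1))
      ⟨0, le_rfl, hT.le⟩ p a 0 B C := by
    refine .of_time_independent hbound (hC.mono has) ?_
    have : (B : ℝ) * (a / (B + 1)) ≤ a := by
      rw [mul_div_assoc', div_le_iff₀ (by positivity)]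
      nlinarith [B.coe_nonneg]
    simpa [max_eq_left hT.le] using this
  obtain ⟨Y, hY0, hY⟩ := hPL.exists_eq_forall_mem_Icc_hasDerivWithinAt₀
  exact ⟨_, hT, Y, hY, hY0⟩

/-- By uniqueness of solutions, the positive limit set of `X 0` is the set of cluster points
of `X`. -/
theorem positiveLimitSet_eq_clusterSet (hF : LocallyLipschitz F) {X : ℝ → E}
    (hX : IsIntegralCurveOn X (fun _ => F) (Ici 0)) :
    positiveLimitSet F (X 0) = {p | MapClusterPt p atTop X} := by
  ext p
  constructor
  · rintro ⟨x, hx, hx0, t, -, htpos, ht, hlim⟩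
    refine MapClusterPt.of_comp ht (Tendsto.mapClusterPt (hlim.congr fun n => ?_))
    exact eqOn_of_isIntegralCurveOn hF hx hX hx0 (htpos n).le
  · intro hp
    obtain ⟨τ, hlim, hτ⟩ := MapClusterPt.exists_seq_tendsto hp
    obtain ⟨N, hN⟩ := eventually_atTop.1 (hτ.eventually_gt_atTop 0)
    have hshift := tendsto_add_atTop_nat N
    obtain ⟨φ, hφ, hmono⟩ := strictMono_subseq_of_tendsto_atTop (hτ.comp hshift)
    exact ⟨X, hX, rfl, _, hmono.monotone, fun n => hN _ (Nat.le_add_left N (φ n)),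
      (hτ.comp hshift).comp hφ.tendsto_atTop, (hlim.comp hshift).comp hφ.tendsto_atTop⟩

theorem positivelyInvariant_clusterSet (hF : LocallyLipschitz F) {K : Set E} (hK : IsCompact K)
    {X : ℝ → E} (hX : IsIntegralCurveOn X (fun _ => F) (Ici 0)) (hXK : ∀ t, 0 ≤ t → X t ∈ K) :
    PositivelyInvariant F {p | MapClusterPt p atTop X} := by
  intro Y hY hY0 t ht
  obtain ⟨τ, hlim, hτ⟩ := MapClusterPt.exists_seq_tendsto hY0
  exact MapClusterPt.of_comp (tendsto_atTop_add_const_left atTop t hτ) (Tendsto.mapClusterPt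
    (tendsto_shift_of_tendsto hF hK hX hXK (hY.mono (Icc_subset_Ici_self : Icc 0 t ⊆ Ici 0))
      hτ hlim ⟨ht, le_rfl⟩))

/-- A set of equilibria is negatively invariant, because constant curves are solutions. -/
theorem negativelyInvariant_of_forall_eq_zero {U : Set E} (hU : ∀ p ∈ U, F p = 0) :
    NegativelyInvariant F U := fun p hp _ _ =>
  ⟨fun _ => p, fun t _ => by simpa only [hU p hp] using hasDerivWithinAt_const t _ p,
    fun _ _ => hp, rfl⟩

/-- A continuous function that decreases to a finite limit along `X` is constant along every
solution issued from a cluster point of `X`. -/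
theorem eq_of_mapClusterPt_of_antitone (hF : LocallyLipschitz F) {K : Set E} (hK : IsCompact K)
    {X : ℝ → E} (hX : IsIntegralCurveOn X (fun _ => F) (Ici 0)) (hXK : ∀ t, 0 ≤ t → X t ∈ K)
    {V : E → ℝ} (hV : Continuous V) (hanti : AntitoneOn (fun t => V (X t)) (Ici 0))
    (hV0 : ∀ x, 0 ≤ V x) {T : ℝ} {Y : ℝ → E} (hY : IsIntegralCurveOn Y (fun _ => F) (Icc 0 T))
    (hY0 : MapClusterPt (Y 0) atTop X) {s : ℝ} (hs : s ∈ Icc 0 T) : V (Y s) = V (Y 0) := by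
  -- Freezing the trajectory for negative times makes `V` antitone on the whole line.
  have hmono : Antitone fun t => V (X (max t 0)) := fun a b hab =>
    hanti (le_max_right a 0) (le_max_right b 0) (max_le_max_right 0 hab)
  have hlimV := tendsto_atTop_ciInf hmono ⟨0, by rintro _ ⟨t, rfl⟩; exact hV0 _⟩
  have hlimV' : Tendsto (fun t => V (X t)) atTop (𝓝 (⨅ t, V (X (max t 0)))) :=
    hlimV.congr' ((eventually_ge_atTop 0).mono fun t ht => by simp only [max_eq_left ht])
  obtain ⟨τ, hlim, hτ⟩ := MapClusterPt.exists_seq_tendsto hY0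
  have key : ∀ r ∈ Icc 0 T, V (Y r) = ⨅ t, V (X (max t 0)) := fun r hr =>
    tendsto_nhds_unique
      ((hV.tendsto _).comp (tendsto_shift_of_tendsto hF hK hX hXK hY hτ hlim hr))
      (hlimV'.comp (tendsto_atTop_add_const_left atTop r hτ))
  rw [key s hs, key 0 ⟨le_rfl, hs.1.trans hs.2⟩]

end Flow

end AutonomousODE

namespace DuhemOscillator

/-! ### Regularity of the vector field and of the energy -/

theorem locallyLipschitz_field {f₁ f₂ g₁ g₂ h₁ h₂ : ℝ → ℝ} {c : EuclideanSpace ℝ (Fin 3) → ℝ}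
    (hf₁ : LocallyLipschitz f₁) (hf₂ : LocallyLipschitz f₂)
    (hg₁ : LocallyLipschitz g₁) (hg₂ : LocallyLipschitz g₂)
    (hh₁ : LocallyLipschitz h₁) (hh₂ : LocallyLipschitz h₂) (hc : LocallyLipschitz c) :
    LocallyLipschitz (field f₁ f₂ g₁ g₂ h₁ h₂ c) := by
  have hcoord : ∀ i : Fin 3, LocallyLipschitz fun X : EuclideanSpace ℝ (Fin 3) => X i := fun i =>
    (EuclideanSpace.proj (𝕜 := ℝ) i).lipschitz.locallyLipschitz
  -- The field is a polynomial map applied to the tuple of its locally Lipschitz ingredients.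
  let Φ : ℝ × (ℝ × ℝ) × (ℝ × ℝ) × (ℝ × ℝ) × ℝ → EuclideanSpace ℝ (Fin 3) := fun y =>
    !₂[y.1, y.1 + y.2.1.1 * y.2.1.2 + y.2.2.1.1 * y.2.2.1.2,
      -y.2.2.2.1.1 - y.2.2.2.1.2 - y.2.2.2.2]
  have hΦ : ContDiff ℝ 1 Φ := by
    refine contDiff_euclidean.2 fun i => ?_
    fin_cases i <;> simp [Φ] <;> fun_prop
  have hX := (hcoord 2).prodMk <|
    ((hf₁.comp (hcoord 1)).prodMk (hg₁.comp (hcoord 2))).prodMk <|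
    ((hf₂.comp (hcoord 1)).prodMk (hg₂.comp (hcoord 2))).prodMk <|
    ((hh₁.comp (hcoord 0)).prodMk (hh₂.comp (hcoord 1))).prodMk hc
  have hfield : field f₁ f₂ g₁ g₂ h₁ h₂ c = Φ ∘ fun X => (X 2, (f₁ (X 1), g₁ (X 2)),
      (f₂ (X 1), g₂ (X 2)), (h₁ (X 0), h₂ (X 1)), c X) := rfl
  rw [hfield]
  exact hΦ.locallyLipschitz.comp hX

theorem hasDerivWithinAt_coord {X : ℝ → EuclideanSpace ℝ (Fin 3)} {d : EuclideanSpace ℝ (Fin 3)}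
    {s : Set ℝ} {t : ℝ} (hX : HasDerivWithinAt X d s t) (i : Fin 3) :
    HasDerivWithinAt (fun r => X r i) (d i) s t :=
  (EuclideanSpace.proj (𝕜 := ℝ) i).hasFDerivAt.comp_hasDerivWithinAt t hX

theorem hasDerivAt_primitive {h : ℝ → ℝ} (hh : Continuous h) (x : ℝ) :
    HasDerivAt (fun u => ∫ s in (0 : ℝ)..u, h s) (h x) x :=
  intervalIntegral.integral_hasDerivAt_right (hh.intervalIntegrable _ _)
    hh.stronglyMeasurable.stronglyMeasurableAtFilter hh.continuousAt

theorem continuous_energy {h₁ h₂ : ℝ → ℝ} (hh₁ : Continuous h₁) (hh₂ : Continuous h₂) :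
    Continuous (energy h₁ h₂) := by
  have hp : ∀ {h : ℝ → ℝ}, Continuous h → Continuous fun u => ∫ s in (0 : ℝ)..u, h s :=
    fun hh => continuous_iff_continuousAt.2 fun x => (hasDerivAt_primitive hh x).continuousAt
  have hp₁ := hp hh₁
  have hp₂ := hp hh₂
  unfold energy
  fun_prop

/-! ### Coercivity of the energy -/

/-- The primitive of a monotone function lies above its tangent lines. -/
theorem mul_sub_le_integral {h : ℝ → ℝ} (hmono : Monotone h) (a x : ℝ) :
    h a * (x - a) ≤ ∫ s in a..x, h s := by
  rcases le_total a x with hax | hxa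
  · have := intervalIntegral.integral_mono_on hax intervalIntegrable_const
      (hmono.intervalIntegrable (μ := MeasureTheory.volume)) fun s hs => hmono hs.1
    simpa [mul_comm] using this
  · have := intervalIntegral.integral_mono_on hxa
      (hmono.intervalIntegrable (μ := MeasureTheory.volume)) intervalIntegrable_const
      fun s hs => hmono hs.2
    rw [intervalIntegral.integral_symm]
    simp only [intervalIntegral.integral_const, smul_eq_mul] at this
    linarith

theorem integral_nonneg_of_monotone {h : ℝ → ℝ} (hmono : Monotone h) (h0 : h 0 = 0) (x : ℝ) :
    0 ≤ ∫ s in (0 : ℝ)..x, h s := by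
  simpa [h0] using mul_sub_le_integral hmono 0 x

theorem energy_nonneg {h₁ h₂ : ℝ → ℝ} (hm₁ : Monotone h₁) (hm₂ : Monotone h₂)
    (h₁0 : h₁ 0 = 0) (h₂0 : h₂ 0 = 0) (X : EuclideanSpace ℝ (Fin 3)) : 0 ≤ energy h₁ h₂ X := by
  have := integral_nonneg_of_monotone hm₁ h₁0 (X 0)
  have := integral_nonneg_of_monotone hm₂ h₂0 (X 1)
  unfold energy
  positivity

/-- The primitive of a strictly increasing function vanishing at `0` grows at least linearly at
both ends, by comparison with its tangent lines at `1` and `-1`. -/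
theorem exists_forall_mem_Icc_of_integral_le {h : ℝ → ℝ} (hmono : StrictMono h) (h0 : h 0 = 0)
    (M : ℝ) : ∃ R, ∀ x, ∫ s in (0 : ℝ)..x, h s ≤ M → x ∈ Icc (-R) R := by
  have hpos : 0 < h 1 := h0 ▸ hmono one_pos
  have hneg : h (-1) < 0 := h0 ▸ hmono neg_one_lt_zero
  refine ⟨max (1 + M / h 1) (1 + M / -h (-1)), fun x hx => ?_⟩
  have htangent : ∀ a, h a * (x - a) ≤ M := fun a => by
    have h1 := mul_sub_le_integral hmono.monotone a x
    have h2 := integral_nonneg_of_monotone hmono.monotone h0 a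
    have h3 := intervalIntegral.integral_add_adjacent_intervals
      (hmono.monotone.intervalIntegrable (μ := MeasureTheory.volume) (a := 0) (b := a))
      (hmono.monotone.intervalIntegrable (μ := MeasureTheory.volume) (a := a) (b := x))
    linarith
  have hup : x - 1 ≤ M / h 1 := (le_div_iff₀ hpos).2 (by linarith [htangent 1])
  have hlo : -x - 1 ≤ M / -h (-1) := (le_div_iff₀ (neg_pos.2 hneg)).2 (by linarith [htangent (-1)])
  have := le_max_left (1 + M / h 1) (1 + M / -h (-1))
  have := le_max_right (1 + M / h 1) (1 + M / -h (-1))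
  constructor <;> linarith

theorem isCompact_sublevelSet {h₁ h₂ : ℝ → ℝ} (hc₁ : Continuous h₁) (hc₂ : Continuous h₂)
    (hm₁ : StrictMono h₁) (hm₂ : StrictMono h₂) (h₁0 : h₁ 0 = 0) (h₂0 : h₂ 0 = 0)
    (X : EuclideanSpace ℝ (Fin 3)) : IsCompact (sublevelSet h₁ h₂ X) := by
  have hclosed : IsClosed (sublevelSet h₁ h₂ X) :=
    isClosed_le (continuous_energy hc₁ hc₂) continuous_const
  obtain ⟨R₁, hR₁⟩ := exists_forall_mem_Icc_of_integral_le hm₁ h₁0 (energy h₁ h₂ X)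
  obtain ⟨R₂, hR₂⟩ := exists_forall_mem_Icc_of_integral_le hm₂ h₂0 (energy h₁ h₂ X)
  let R : Fin 3 → ℝ := ![R₁, R₂, Real.sqrt (2 * energy h₁ h₂ X)]
  have hbox : IsCompact (EuclideanSpace.equiv (Fin 3) ℝ ⁻¹' Icc (-R) R) :=
    (EuclideanSpace.equiv (Fin 3) ℝ).toHomeomorph.isCompact_preimage.2 isCompact_Icc
  refine hbox.of_isClosed_subset hclosed fun Y hY => ?_
  have hY' : energy h₁ h₂ Y ≤ energy h₁ h₂ X := hY
  have hi₁ := integral_nonneg_of_monotone hm₁.monotone h₁0 (Y 0)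
  have hi₂ := integral_nonneg_of_monotone hm₂.monotone h₂0 (Y 1)
  have hsq := sq_nonneg (Y 2)
  unfold energy at hY'
  have hx := hR₁ (Y 0) (by unfold energy; linarith)
  have hz := hR₂ (Y 1) (by unfold energy; linarith)
  have hv := abs_le.1 (Real.abs_le_sqrt (show Y 2 ^ 2 ≤ 2 * energy h₁ h₂ X by
    unfold energy; linarith))
  constructor <;> intro i <;> fin_cases i
  exacts [hx.1, hz.1, hv.1, hx.2, hz.2, hv.2]

/-! ### Dissipation of energy -/

/-- The derivative of the energy along the solutions. The conservative terms `h₁(x) v` and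
`h₂(z) v` cancel. -/
noncomputable def power (f₁ f₂ g₁ g₂ h₂ : ℝ → ℝ) (c : EuclideanSpace ℝ (Fin 3) → ℝ)
    (X : EuclideanSpace ℝ (Fin 3)) : ℝ :=
  h₂ (X 1) * (f₁ (X 1) * g₁ (X 2) + f₂ (X 1) * g₂ (X 2)) - X 2 * c X

theorem hasDerivWithinAt_energy {f₁ f₂ g₁ g₂ h₁ h₂ : ℝ → ℝ} {c : EuclideanSpace ℝ (Fin 3) → ℝ}
    (hc₁ : Continuous h₁) (hc₂ : Continuous h₂) {X : ℝ → EuclideanSpace ℝ (Fin 3)} {s : Set ℝ}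
    (hX : IsIntegralCurveOn X (fun _ => field f₁ f₂ g₁ g₂ h₁ h₂ c) s) {t : ℝ} (ht : t ∈ s) :
    HasDerivWithinAt (fun r => energy h₁ h₂ (X r)) (power f₁ f₂ g₁ g₂ h₂ c (X t)) s t := by
  have hcoord := hasDerivWithinAt_coord (hX t ht)
  have h0 := (hasDerivAt_primitive hc₁ (X t 0)).comp_hasDerivWithinAt t (hcoord 0)
  have h1 := (hasDerivAt_primitive hc₂ (X t 1)).comp_hasDerivWithinAt t (hcoord 1)
  have h2 := ((hcoord 2).pow 2).const_mul (1 / 2 : ℝ)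
  refine ((h0.add h1).add h2).congr_deriv ?_
  simp [field, power]
  ring

section Signs

variable {f₁ f₂ g₁ g₂ h₂ : ℝ → ℝ} {c : EuclideanSpace ℝ (Fin 3) → ℝ}

/-- When the internal variable `z` and the velocity `v` are both nonzero, the hysteretic term
strictly dissipates energy. -/
theorem hysteretic_power_neg (hm : StrictMono h₂) (h0 : h₂ 0 = 0)
    (hf_neg : ∀ z : ℝ, z < 0 → 0 < f₁ z ∧ f₂ z < 0)
    (hf_pos : ∀ z : ℝ, 0 < z → f₁ z < 0 ∧ 0 < f₂ z)
    (hg_pos : ∀ v : ℝ, 0 < v → 0 < g₁ v ∧ g₂ v = 0)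
    (hg_neg : ∀ v : ℝ, v < 0 → g₁ v = 0 ∧ g₂ v < 0) {z v : ℝ} (hz : z ≠ 0) (hv : v ≠ 0) :
    h₂ z * (f₁ z * g₁ v + f₂ z * g₂ v) < 0 := by
  rcases hz.lt_or_gt with hz | hz <;> rcases hv.lt_or_gt with hv | hv
  · have hh : h₂ z < 0 := h0 ▸ hm hz
    obtain ⟨e, hg⟩ := hg_neg v hv
    rw [e, mul_zero, zero_add]
    exact mul_neg_of_neg_of_pos hh (mul_pos_of_neg_of_neg (hf_neg z hz).2 hg)
  · have hh : h₂ z < 0 := h0 ▸ hm hz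
    obtain ⟨hg, e⟩ := hg_pos v hv
    rw [e, mul_zero, add_zero]
    exact mul_neg_of_neg_of_pos hh (mul_pos (hf_neg z hz).1 hg)
  · have hh : 0 < h₂ z := h0 ▸ hm hz
    obtain ⟨e, hg⟩ := hg_neg v hv
    rw [e, mul_zero, zero_add]
    exact mul_neg_of_pos_of_neg hh (mul_neg_of_pos_of_neg (hf_pos z hz).2 hg)
  · have hh : 0 < h₂ z := h0 ▸ hm hz
    obtain ⟨hg, e⟩ := hg_pos v hv
    rw [e, mul_zero, add_zero]
    exact mul_neg_of_pos_of_neg hh (mul_neg_of_neg_of_pos (hf_pos z hz).1 hg)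

theorem power_neg (hm : StrictMono h₂) (h0 : h₂ 0 = 0)
    (hf_neg : ∀ z : ℝ, z < 0 → 0 < f₁ z ∧ f₂ z < 0)
    (hf_pos : ∀ z : ℝ, 0 < z → f₁ z < 0 ∧ 0 < f₂ z)
    (hg_pos : ∀ v : ℝ, 0 < v → 0 < g₁ v ∧ g₂ v = 0)
    (hg_neg : ∀ v : ℝ, v < 0 → g₁ v = 0 ∧ g₂ v < 0)
    (hc_nonneg : ∀ X : EuclideanSpace ℝ (Fin 3), 0 ≤ X 2 * c X)
    {X : EuclideanSpace ℝ (Fin 3)} (hz : X 1 ≠ 0) (hv : X 2 ≠ 0) :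
    power f₁ f₂ g₁ g₂ h₂ c X < 0 := by
  have := hysteretic_power_neg hm h0 hf_neg hf_pos hg_pos hg_neg hz hv
  unfold power
  linarith [hc_nonneg X]

theorem power_nonpos (hm : StrictMono h₂) (h0 : h₂ 0 = 0)
    (hf_neg : ∀ z : ℝ, z < 0 → 0 < f₁ z ∧ f₂ z < 0)
    (hf_pos : ∀ z : ℝ, 0 < z → f₁ z < 0 ∧ 0 < f₂ z)
    (hg₁0 : g₁ 0 = 0) (hg₂0 : g₂ 0 = 0)
    (hg_pos : ∀ v : ℝ, 0 < v → 0 < g₁ v ∧ g₂ v = 0)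
    (hg_neg : ∀ v : ℝ, v < 0 → g₁ v = 0 ∧ g₂ v < 0)
    (hc_nonneg : ∀ X : EuclideanSpace ℝ (Fin 3), 0 ≤ X 2 * c X)
    (X : EuclideanSpace ℝ (Fin 3)) : power f₁ f₂ g₁ g₂ h₂ c X ≤ 0 := by
  by_cases hv : X 2 = 0
  · simp [power, hv, hg₁0, hg₂0]
  by_cases hz : X 1 = 0
  · simpa [power, hz, h0] using hc_nonneg X
  · exact (power_neg hm h0 hf_neg hf_pos hg_pos hg_neg hc_nonneg hz hv).le

end Signs

/-! ### Equilibria and solutions of constant energy -/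

section Equilibria

variable {f₁ f₂ g₁ g₂ h₁ h₂ : ℝ → ℝ} {c : EuclideanSpace ℝ (Fin 3) → ℝ}

theorem field_eq_zero_of_mem_equilibriumSet (hg₁0 : g₁ 0 = 0) (hg₂0 : g₂ 0 = 0)
    (hc_zero : ∀ X : EuclideanSpace ℝ (Fin 3), X 2 = 0 → c X = 0)
    {X : EuclideanSpace ℝ (Fin 3)} (hX : X ∈ equilibriumSet h₁ h₂) :
    field f₁ f₂ g₁ g₂ h₁ h₂ c X = 0 := by
  obtain ⟨hh, hv⟩ := hX
  ext i
  fin_cases i <;> simp [field, hv, hg₁0, hg₂0, hc_zero X hv, hh]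

/-- A solution that dissipates no energy starts at an equilibrium. Dissipating nothing forces
`z = 0` or `v = 0` at all times; if `v` were nonzero at some time, `z` would vanish around that
time, although its derivative there is `v`. So `v` vanishes identically, and so does its
derivative. -/
theorem mem_equilibriumSet_of_energy_constant (hc₁ : Continuous h₁) (hc₂ : Continuous h₂)
    (hf₁0 : f₁ 0 = 0) (hf₂0 : f₂ 0 = 0)
    (hc_zero : ∀ X : EuclideanSpace ℝ (Fin 3), X 2 = 0 → c X = 0)
    (hpower : ∀ X : EuclideanSpace ℝ (Fin 3), X 1 ≠ 0 → X 2 ≠ 0 →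
      power f₁ f₂ g₁ g₂ h₂ c X < 0)
    {T : ℝ} (hT : 0 < T) {Y : ℝ → EuclideanSpace ℝ (Fin 3)}
    (hY : IsIntegralCurveOn Y (fun _ => field f₁ f₂ g₁ g₂ h₁ h₂ c) (Icc 0 T))
    (hconst : ∀ t ∈ Icc 0 T, energy h₁ h₂ (Y t) = energy h₁ h₂ (Y 0)) :
    Y 0 ∈ equilibriumSet h₁ h₂ := by
  have hzero : ∀ {u : ℝ → ℝ} {d k t : ℝ}, t ∈ Icc 0 T → HasDerivWithinAt u d (Icc 0 T) t →
      (∀ᶠ r in 𝓝[Icc 0 T] t, u r = k) → d = 0 := fun ht hu hk =>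
    (uniqueDiffOn_Icc hT _ ht).eq_deriv _ hu
      ((hasDerivWithinAt_const _ _ _).congr_of_eventuallyEq_of_mem hk ht)
  have hpower0 : ∀ t ∈ Icc 0 T, Y t 2 ≠ 0 → Y t 1 = 0 := by
    intro t ht hv
    by_contra hz
    exact (hpower _ hz hv).ne (hzero ht (hasDerivWithinAt_energy hc₁ hc₂ hY ht)
      (eventually_mem_nhdsWithin.mono hconst))
  have hv0 : ∀ t ∈ Icc 0 T, Y t 2 = 0 := by
    intro t ht
    by_contra hv
    have hne : ∀ᶠ r in 𝓝[Icc 0 T] t, Y r 2 ≠ 0 :=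
      (hasDerivWithinAt_coord (hY t ht) 2).continuousWithinAt.eventually_ne hv
    have hd := hzero ht (hasDerivWithinAt_coord (hY t ht) 1)
      (hne.mp (eventually_mem_nhdsWithin.mono hpower0))
    exact hv (by simpa [field, hpower0 t ht hv, hf₁0, hf₂0] using hd)
  have h0 : (0 : ℝ) ∈ Icc 0 T := ⟨le_rfl, hT.le⟩
  have hd := hzero h0 (hasDerivWithinAt_coord (hY 0 h0) 2) (eventually_mem_nhdsWithin.mono hv0)
  simp only [field, hc_zero _ (hv0 0 h0)] at hd
  exact ⟨by simp at hd; linarith, hv0 0 h0⟩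

end Equilibria

end DuhemOscillator

/-! ### The positive limit set of the oscillator -/

open AutonomousODE DuhemOscillator in
theorem mainTheorem3
    (f₁ f₂ g₁ g₂ h₁ h₂ : ℝ → ℝ) (c : EuclideanSpace ℝ (Fin 3) → ℝ)
    (hf₁ : LocallyLipschitz f₁) (hf₂ : LocallyLipschitz f₂)
    (hg₁ : LocallyLipschitz g₁) (hg₂ : LocallyLipschitz g₂)
    (hh₁ : LocallyLipschitz h₁) (hh₂ : LocallyLipschitz h₂)
    (hh₁_mono : StrictMono h₁) (hh₂_mono : StrictMono h₂)
    (hf₁_zero : f₁ 0 = 0) (hf₂_zero : f₂ 0 = 0)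
    (hg₁_zero : g₁ 0 = 0) (hg₂_zero : g₂ 0 = 0)
    (hh₁_zero : h₁ 0 = 0) (hh₂_zero : h₂ 0 = 0)
    (hf_neg : ∀ z : ℝ, z < 0 → 0 < f₁ z ∧ f₂ z < 0)
    (hf_pos : ∀ z : ℝ, 0 < z → f₁ z < 0 ∧ 0 < f₂ z)
    (hg_pos : ∀ v : ℝ, 0 < v → 0 < g₁ v ∧ g₂ v = 0)
    (hg_neg : ∀ v : ℝ, v < 0 → g₁ v = 0 ∧ g₂ v < 0)
    (hc : LocallyLipschitz c)
    (hc_zero : ∀ x z : ℝ, c !₂[x, z, 0] = 0)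
    (hc_nonneg : ∀ x z v : ℝ, 0 ≤ v * c !₂[x, z, v])
    (X : ℝ → EuclideanSpace ℝ (Fin 3))
    (hX : IsIntegralCurveOn X (fun _ => DuhemOscillator.field f₁ f₂ g₁ g₂ h₁ h₂ c) (Set.Ici 0)) :
    let F := DuhemOscillator.field f₁ f₂ g₁ g₂ h₁ h₂ c
    let L := AutonomousODE.positiveLimitSet F (X 0)
    L.Nonempty ∧ IsCompact L ∧ IsConnected L ∧ AutonomousODE.Invariant F L ∧
      AutonomousODE.ConvergesToSet X L ∧
      L ⊆ DuhemOscillator.sublevelSet h₁ h₂ (X 0) ∩ DuhemOscillator.equilibriumSet h₁ h₂ := by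
  intro F L
  have hF : LocallyLipschitz F := locallyLipschitz_field hf₁ hf₂ hg₁ hg₂ hh₁ hh₂ hc
  have hcoords : ∀ Y : EuclideanSpace ℝ (Fin 3), Y = !₂[Y 0, Y 1, Y 2] := fun Y => by
    ext i
    fin_cases i <;> rfl
  have hc_zero' : ∀ Y : EuclideanSpace ℝ (Fin 3), Y 2 = 0 → c Y = 0 := fun Y hY => by
    rw [hcoords Y, hY]
    exact hc_zero _ _
  have hc_nonneg' : ∀ Y : EuclideanSpace ℝ (Fin 3), 0 ≤ Y 2 * c Y := fun Y => by
    have := hc_nonneg (Y 0) (Y 1) (Y 2)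
    rwa [← hcoords Y] at this
  have hanti : AntitoneOn (fun t => energy h₁ h₂ (X t)) (Ici 0) :=
    antitoneOn_of_hasDerivWithinAt_nonpos (convex_Ici 0)
      ((continuous_energy hh₁.continuous hh₂.continuous).comp_continuousOn hX.continuousOn)
      (fun t ht => (hasDerivWithinAt_energy hh₁.continuous hh₂.continuous hX
        (interior_subset ht)).mono interior_subset)
      fun t _ => power_nonpos hh₂_mono hh₂_zero hf_neg hf_pos hg₁_zero hg₂_zero hg_pos hg_neg
        hc_nonneg' (X t)
  have hK := isCompact_sublevelSet hh₁.continuous hh₂.continuous hh₁_mono hh₂_mono hh₁_zero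
    hh₂_zero (X 0)
  have hXK : ∀ t, 0 ≤ t → X t ∈ sublevelSet h₁ h₂ (X 0) := fun t ht =>
    hanti self_mem_Ici ht ht
  have hL : L = {p | MapClusterPt p atTop X} := positiveLimitSet_eq_clusterSet hF hX
  have hLE : L ⊆ equilibriumSet h₁ h₂ := by
    intro p hp
    rw [hL] at hp
    obtain ⟨T, hT, Y, hY, rfl⟩ := exists_isIntegralCurveOn_Icc hF p
    exact mem_equilibriumSet_of_energy_constant hh₁.continuous hh₂.continuous hf₁_zero hf₂_zero
      hc_zero' (fun Z => power_neg hh₂_mono hh₂_zero hf_neg hf_pos hg_pos hg_neg hc_nonneg') hT hY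
      fun t ht => eq_of_mapClusterPt_of_antitone hF hK hX hXK
        (continuous_energy hh₁.continuous hh₂.continuous) hanti
        (energy_nonneg hh₁_mono.monotone hh₂_mono.monotone hh₁_zero hh₂_zero) hY hp ht
  have hneg : NegativelyInvariant F L := negativelyInvariant_of_forall_eq_zero fun p hp =>
    field_eq_zero_of_mem_equilibriumSet hg₁_zero hg₂_zero hc_zero' (hLE hp)
  rw [hL] at hLE hneg ⊢
  exact ⟨clusterSet_nonempty hK hXK, isCompact_clusterSet hK hXK,
    isConnected_clusterSet hK hXK hX.continuousOn,
    ⟨positivelyInvariant_clusterSet hF hK hX hXK, hneg⟩, convergesToSet_clusterSet hK hXK,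
    subset_inter (clusterSet_subset hK hXK) hLE⟩
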